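/- Let $(X,d)$ be a nonempty compact metric space, fix an arbitrary point $x_0\in X$, and let $\mathrm{cabv}(X)$ be the real vector space of countably additive real-valued Borel measures of bounded variation on $X$, with total variation norm $\|\mu\|_{TV}=|\mu|(X)$. Let $\mathrm{cabv}(X,0)=\{\nu\in \mathrm{cabv}(X):\nu(X)=0\}$. Let $\mathrm{Lip}(X)$ be the space of Lipschitz functions $f:X\to\mathbb R$, and put $$\|f\|_L=\sup_{x\neq y}\frac{|f(x)-f(y)|}{d(x,y)},\qquad \|f\|_\infty=\sup_{x\in X}|f(x)|,\qquad \|f\|_{sum}=\|f\|_L+\|f\|_\infty$$ (with $\|f\|_L=0$ if $X$ has only one point). For $\mu\in \mathrm{cabv}(X)$ and $\nu\in \mathrm{cabv}(X,0)$ define the Monge–Kantorovich, Kantorovich–Rubinstein and Hanin norms by $$\|\mu\|_{MK}=\sup\Big\{\int f\,d\mu: f\in \mathrm{Lip}(X),\ \|f\|_{sum}\le 1\Big\},$$ $$\|\nu\|_{KR}=\sup\Big\{\int f\,d\nu: f\in \mathrm{Lip}(X),\ f(x_0)=0,\ \|f\|_L\le 1\Big\},$$ $$\|\mu\|_{H}=\inf_{\nu\in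 \mathrm{cabv}(X,0)}\big(\|\nu\|_{KR}+\|\mu-\nu\|_{TV}\big).$$ Then: 1. for every $\mu\in \mathrm{cabv}(X)$, $\displaystyle \|\mu\|_{MK}=\inf_{\nu\in \mathrm{cabv}(X,0)}\max\{\|\nu\|_{KR},\|\mu-\nu\|_{TV}\}$; 2. for every $\mu\in \mathrm{cabv}(X)$ there is $f\in \mathrm{Lip}(X)$ with $\|f\|_{sum}=1$ and $\|\mu\|_{MK}=\int f\,d\mu$; 3. the measures with finite support are dense in $(\mathrm{cabv}(X),\|\cdot\|_{MK})$; 4. the topological dual of $(\mathrm{cabv}(X),\|\cdot\|_{MK})$ is isometrically isomorphic to $(\mathrm{Lip}(X),\|\cdot\|_{sum})$, the function $f\in \mathrm{Lip}(X)$ corresponding to the functional $\mu\mapsto\int f\,d\mu$; 5. for every $\mu\in \mathrm{cabv}(X)$, $\|\mu\|_{MK}\le\|\mu\|_H\le 2\|\mu\|_{MK}$; in particular the two norms are equivalent. -/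

import Mathlib

open MeasureTheory

namespace MongeKantorovich

noncomputable section

variable {X : Type*}

section Functions

variable [MetricSpace X]

/-- The real vector space of Lipschitz functions `X → ℝ`. -/
def lip (X : Type*) [MetricSpace X] : Submodule ℝ (X → ℝ) where
  carrier := {f | ∃ K, LipschitzWith K f}
  add_mem' := by
    rintro f g ⟨K, hK⟩ ⟨L, hL⟩
    exact ⟨K + L, hK.add hL⟩
  zero_mem' := ⟨0, LipschitzWith.const 0⟩
  smul_mem' := by
    rintro c f ⟨K, hK⟩
    exact ⟨‖c‖₊ * K, (lipschitzWith_smul c).comp hK⟩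

/-- The Lipschitz seminorm, the supremum of `|f x - f y| / d(x, y)` over all pairs `x ≠ y`
(`0` if there are no such pairs). -/
def lipSeminorm (f : X → ℝ) : ℝ :=
  ⨆ p : {p : X × X // p.1 ≠ p.2}, |f p.1.1 - f p.1.2| / dist p.1.1 p.1.2

/-- The supremum norm of a bounded function. -/
def supNorm (f : X → ℝ) : ℝ := ⨆ x, |f x|

/-- The sum norm `‖f‖_L + ‖f‖_∞`. -/
def sumNorm (f : X → ℝ) : ℝ := lipSeminorm f + supNorm f

theorem lipSeminorm_nonneg (f : X → ℝ) : 0 ≤ lipSeminorm f :=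
  Real.iSup_nonneg fun _ => by positivity

theorem supNorm_nonneg {X : Type*} (f : X → ℝ) : 0 ≤ supNorm f :=
  Real.iSup_nonneg fun _ => abs_nonneg _

theorem sumNorm_nonneg (f : X → ℝ) : 0 ≤ sumNorm f :=
  add_nonneg (lipSeminorm_nonneg f) (supNorm_nonneg f)

theorem lipSeminorm_bddAbove {f : X → ℝ} (hf : f ∈ lip X) :
    BddAbove (Set.range fun p : {p : X × X // p.1 ≠ p.2} =>
      |f p.1.1 - f p.1.2| / dist p.1.1 p.1.2) := by
  obtain ⟨K, hK⟩ := hf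
  refine ⟨K, ?_⟩
  rintro _ ⟨⟨⟨x, y⟩, hxy⟩, rfl⟩
  have h := hK.dist_le_mul x y
  rw [Real.dist_eq] at h
  exact (div_le_iff₀ (dist_pos.2 hxy)).2 h

theorem supNorm_bddAbove [CompactSpace X] {f : X → ℝ} (hf : f ∈ lip X) :
    BddAbove (Set.range fun x => |f x|) := by
  obtain ⟨K, hK⟩ := hf
  exact (isCompact_range (continuous_abs.comp hK.continuous)).bddAbove

theorem abs_le_supNorm [CompactSpace X] {f : X → ℝ} (hf : f ∈ lip X) (x : X) :
    |f x| ≤ supNorm f :=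
  le_ciSup (supNorm_bddAbove hf) x

theorem lipSeminorm_add_le {f g : X → ℝ} (hf : f ∈ lip X) (hg : g ∈ lip X) :
    lipSeminorm (f + g) ≤ lipSeminorm f + lipSeminorm g := by
  refine Real.iSup_le (fun p => ?_) (add_nonneg (lipSeminorm_nonneg f) (lipSeminorm_nonneg g))
  have h1 := le_ciSup (lipSeminorm_bddAbove hf) p
  have h2 := le_ciSup (lipSeminorm_bddAbove hg) p
  refine le_trans ?_ (add_le_add h1 h2)
  rw [← add_div]
  refine div_le_div_of_nonneg_right ?_ dist_nonneg
  have h3 : (f + g) p.1.1 - (f + g) p.1.2 = (f p.1.1 - f p.1.2) + (g p.1.1 - g p.1.2) := by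
    simp only [Pi.add_apply]; ring
  rw [h3]
  exact abs_add_le _ _

theorem supNorm_add_le [CompactSpace X] {f g : X → ℝ} (hf : f ∈ lip X) (hg : g ∈ lip X) :
    supNorm (f + g) ≤ supNorm f + supNorm g :=
  Real.iSup_le (fun x => (abs_add_le _ _).trans
    (add_le_add (abs_le_supNorm hf x) (abs_le_supNorm hg x)))
    (add_nonneg (supNorm_nonneg f) (supNorm_nonneg g))

theorem sumNorm_smul (c : ℝ) (f : X → ℝ) : sumNorm (c • f) = |c| * sumNorm f := by
  have h1 : lipSeminorm (c • f) = |c| * lipSeminorm f := by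
    unfold lipSeminorm
    rw [Real.mul_iSup_of_nonneg (abs_nonneg c)]
    refine congrArg _ (funext fun p => ?_)
    simp only [Pi.smul_apply, smul_eq_mul]
    rw [← mul_sub, abs_mul, mul_div_assoc]
  have h2 : supNorm (c • f) = |c| * supNorm f := by
    unfold supNorm
    rw [Real.mul_iSup_of_nonneg (abs_nonneg c)]
    simp [abs_mul]
  rw [sumNorm, sumNorm, h1, h2, mul_add]

theorem sumNorm_zero : sumNorm (0 : X → ℝ) = 0 := by
  have h := sumNorm_smul (0 : ℝ) (0 : X → ℝ)
  rwa [zero_smul, abs_zero, zero_mul] at h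

theorem sumNorm_add_le [CompactSpace X] {f g : X → ℝ} (hf : f ∈ lip X) (hg : g ∈ lip X) :
    sumNorm (f + g) ≤ sumNorm f + sumNorm g := by
  have h1 := lipSeminorm_add_le hf hg
  have h2 := supNorm_add_le hf hg
  unfold sumNorm
  linarith

/-- `Lip(X)` as a normed space under the sum norm. -/
def LipSum (X : Type*) [MetricSpace X] : Type _ := lip X

instance : AddCommGroup (LipSum X) := inferInstanceAs (AddCommGroup (lip X))
instance : Module ℝ (LipSum X) := inferInstanceAs (Module ℝ (lip X))

/-- The identity from `Lip(X)` with the sum norm to the bare vector space `Lip(X)`. -/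
def LipSum.toLip : LipSum X ≃ₗ[ℝ] lip X := LinearEquiv.refl ℝ (lip X)

instance : Norm (LipSum X) := ⟨fun f => sumNorm (LipSum.toLip f : X → ℝ)⟩

theorem LipSum.norm_def (f : LipSum X) : ‖f‖ = sumNorm (LipSum.toLip f : X → ℝ) := rfl

theorem LipSum.core [CompactSpace X] : NormedSpace.Core ℝ (LipSum X) where
  norm_nonneg f := sumNorm_nonneg _
  norm_smul c f := sumNorm_smul c _
  norm_triangle f g := sumNorm_add_le (LipSum.toLip f).2 (LipSum.toLip g).2
  norm_eq_zero_iff f := by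
    constructor
    · intro h
      have h1 := lipSeminorm_nonneg (LipSum.toLip f : X → ℝ)
      have h2 : supNorm (LipSum.toLip f : X → ℝ) ≤ 0 := by
        rw [LipSum.norm_def, sumNorm] at h
        linarith
      apply LipSum.toLip.injective
      rw [map_zero]
      ext x
      exact abs_nonpos_iff.1 ((abs_le_supNorm (LipSum.toLip f).2 x).trans h2)
    · rintro rfl
      exact sumNorm_zero

instance [CompactSpace X] : NormedAddCommGroup (LipSum X) :=
  NormedAddCommGroup.ofCore LipSum.core
instance [CompactSpace X] : NormedSpace ℝ (LipSum X) :=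
  NormedSpace.ofCore LipSum.core

end Functions

section Measures

/-- The total variation norm `|μ|(X)`. -/
def tvNorm [MeasurableSpace X] (μ : SignedMeasure X) : ℝ := μ.variation.real Set.univ

/-- The subspace of signed measures of zero total charge. -/
def zeroCharge (X : Type*) [MeasurableSpace X] : Submodule ℝ (SignedMeasure X) where
  carrier := {ν | ν Set.univ = 0}
  add_mem' := by
    intro μ ν hμ hν
    simp_all
  zero_mem' := by simp
  smul_mem' := by
    intro c μ hμ
    simp_all

variable [MetricSpace X] [MeasurableSpace X]

/-- The Monge–Kantorovich norm. -/
def mkNorm (μ : SignedMeasure X) : ℝ :=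
  sSup {r | ∃ f ∈ lip X, sumNorm f ≤ 1 ∧ r = ∫ᵛ x, f x ∂<•μ}

/-- The (modified) Kantorovich–Rubinstein norm with base point `x₀`, to be used on measures of
zero charge. -/
def krNorm (x₀ : X) (ν : SignedMeasure X) : ℝ :=
  sSup {r | ∃ f ∈ lip X, f x₀ = 0 ∧ lipSeminorm f ≤ 1 ∧ r = ∫ᵛ x, f x ∂<•ν}

/-- The Hanin norm. -/
def haninNorm (x₀ : X) (μ : SignedMeasure X) : ℝ :=
  ⨅ ν : zeroCharge X, (krNorm x₀ (ν : SignedMeasure X) + tvNorm (μ - (ν : SignedMeasure X)))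

/-- `cabv(X)` as a normed space under the Monge–Kantorovich norm. A countably additive real
measure is automatically of bounded variation. -/
def CabvMK (X : Type*) [MeasurableSpace X] : Type _ := SignedMeasure X

instance : AddCommGroup (CabvMK X) := inferInstanceAs (AddCommGroup (SignedMeasure X))
instance : Module ℝ (CabvMK X) := inferInstanceAs (Module ℝ (SignedMeasure X))

/-- The identity from `cabv(X)` with the Monge–Kantorovich norm to the bare vector space of
signed measures. -/
def CabvMK.toSignedMeasure : CabvMK X ≃ₗ[ℝ] SignedMeasure X :=
  LinearEquiv.refl ℝ (SignedMeasure X)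

instance : Norm (CabvMK X) := ⟨fun μ => mkNorm (CabvMK.toSignedMeasure μ)⟩

theorem CabvMK.norm_def (μ : CabvMK X) : ‖μ‖ = mkNorm (CabvMK.toSignedMeasure μ) := rfl

theorem mkNorm_le {μ : SignedMeasure X} {C : ℝ}
    (h : ∀ f ∈ lip X, sumNorm f ≤ 1 → ∫ᵛ x, f x ∂<•μ ≤ C) : mkNorm μ ≤ C := by
  refine csSup_le ⟨0, 0, zero_mem _, ?_, by simp⟩ ?_
  · rw [sumNorm_zero]; exact zero_le_one
  · rintro _ ⟨f, hf, h1, rfl⟩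
    exact h f hf h1

theorem isFiniteMeasure_variation {X : Type*} [MeasurableSpace X] (μ : SignedMeasure X) :
    IsFiniteMeasure μ.variation := by
  rw [← SignedMeasure.totalVariation_eq_variation]
  infer_instance

variable [CompactSpace X]

theorem integral_le_sumNorm_mul (μ : SignedMeasure X) {f : X → ℝ} (hf : f ∈ lip X) :
    |∫ᵛ x, f x ∂<•μ| ≤ sumNorm f * tvNorm μ := by
  have := isFiniteMeasure_variation μ
  have h0 : 0 ≤ tvNorm μ := measureReal_nonneg
  have h1 : ‖∫ᵛ x, f x ∂<•μ‖ ≤ supNorm f * tvNorm μ := by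
    have h := VectorMeasure.norm_integral_le_of_norm_le_const (μ := μ) (f := f)
      (B := (ContinuousLinearMap.lsmul ℝ ℝ).flip) (C := supNorm f)
      (Filter.Eventually.of_forall fun x => abs_le_supNorm hf x)
    refine h.trans ?_
    have hB : ‖(ContinuousLinearMap.lsmul ℝ ℝ : ℝ →L[ℝ] ℝ →L[ℝ] ℝ).flip‖ ≤ 1 := by
      rw [ContinuousLinearMap.opNorm_flip]
      exact ContinuousLinearMap.opNorm_lsmul_le
    have hC := supNorm_nonneg f
    calc supNorm f * ‖(ContinuousLinearMap.lsmul ℝ ℝ : ℝ →L[ℝ] ℝ →L[ℝ] ℝ).flip‖ *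
          μ.variation.real Set.univ ≤ supNorm f * 1 * tvNorm μ := by
          unfold tvNorm
          gcongr
      _ = supNorm f * tvNorm μ := by rw [mul_one]
  refine h1.trans (mul_le_mul_of_nonneg_right ?_ h0)
  exact le_add_of_nonneg_left (lipSeminorm_nonneg f)

variable [BorelSpace X]

theorem integrable_of_mem_lip (μ : SignedMeasure X) {f : X → ℝ} (hf : f ∈ lip X) :
    μ.Integrable f := by
  have := isFiniteMeasure_variation μ
  obtain ⟨K, hK⟩ := id hf
  exact Integrable.of_bound hK.continuous.aestronglyMeasurable (supNorm f)
    (Filter.Eventually.of_forall fun x => abs_le_supNorm hf x)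

theorem mkNorm_bddAbove (μ : SignedMeasure X) :
    BddAbove {r | ∃ f ∈ lip X, sumNorm f ≤ 1 ∧ r = ∫ᵛ x, f x ∂<•μ} := by
  refine ⟨tvNorm μ, ?_⟩
  rintro _ ⟨f, hf, h1, rfl⟩
  have h0 : 0 ≤ tvNorm μ := measureReal_nonneg
  have h2 := integral_le_sumNorm_mul μ hf
  nlinarith [le_abs_self (∫ᵛ x, f x ∂<•μ)]

theorem mkNorm_nonneg (μ : SignedMeasure X) : 0 ≤ mkNorm μ := by
  refine le_csSup (mkNorm_bddAbove μ) ⟨0, zero_mem _, ?_, ?_⟩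
  · rw [sumNorm_zero]; exact zero_le_one
  · simp

theorem integral_le_mkNorm (μ : SignedMeasure X) {f : X → ℝ} (hf : f ∈ lip X)
    (h : sumNorm f ≤ 1) : ∫ᵛ x, f x ∂<•μ ≤ mkNorm μ :=
  le_csSup (mkNorm_bddAbove μ) ⟨f, hf, h, rfl⟩

theorem mkNorm_add_le (μ ν : SignedMeasure X) : mkNorm (μ + ν) ≤ mkNorm μ + mkNorm ν := by
  refine mkNorm_le fun f hf h => ?_
  rw [VectorMeasure.integral_add_vectorMeasure (integrable_of_mem_lip μ hf)
    (integrable_of_mem_lip ν hf)]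
  exact add_le_add (integral_le_mkNorm μ hf h) (integral_le_mkNorm ν hf h)

theorem mkNorm_smul_le (c : ℝ) (μ : SignedMeasure X) : mkNorm (c • μ) ≤ |c| * mkNorm μ := by
  refine mkNorm_le fun f hf h => ?_
  rw [VectorMeasure.integral_smul_vectorMeasure, smul_eq_mul]
  rcases le_total 0 c with hc | hc
  · rw [abs_of_nonneg hc]
    exact mul_le_mul_of_nonneg_left (integral_le_mkNorm μ hf h) hc
  · rw [abs_of_nonpos hc]
    have h1 : sumNorm ((-1 : ℝ) • f) ≤ 1 := by rw [sumNorm_smul]; simpa using h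
    have h2 := integral_le_mkNorm μ (Submodule.smul_mem _ (-1 : ℝ) hf) h1
    have h3 : ∫ᵛ x, ((-1 : ℝ) • f) x ∂<•μ = - ∫ᵛ x, f x ∂<•μ := by
      simp only [Pi.smul_apply, neg_smul, one_smul]
      exact VectorMeasure.integral_fun_neg (μ := μ) (B := (ContinuousLinearMap.lsmul ℝ ℝ).flip) f
    rw [h3] at h2
    nlinarith

theorem mkNorm_smul (c : ℝ) (μ : SignedMeasure X) : mkNorm (c • μ) = |c| * mkNorm μ := by
  refine le_antisymm (mkNorm_smul_le c μ) ?_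
  rcases eq_or_ne c 0 with rfl | hc
  · simpa using mkNorm_nonneg _
  · have h := mkNorm_smul_le c⁻¹ (c • μ)
    rw [smul_smul, inv_mul_cancel₀ hc, one_smul, abs_inv] at h
    have h2 := abs_pos.2 hc
    calc |c| * mkNorm μ ≤ |c| * (|c|⁻¹ * mkNorm (c • μ)) := by gcongr
      _ = mkNorm (c • μ) := by field_simp

theorem integral_eq_zero_of_mkNorm_eq_zero {μ : SignedMeasure X} (h : mkNorm μ = 0)
    {f : X → ℝ} (hf : f ∈ lip X) : ∫ᵛ x, f x ∂<•μ = 0 := by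
  have hs := sumNorm_nonneg f
  have key : ∀ c : ℝ, |c| * sumNorm f ≤ 1 → c * ∫ᵛ x, f x ∂<•μ ≤ 0 := by
    intro c hc
    have h1 := integral_le_mkNorm μ (Submodule.smul_mem _ c hf) (by rwa [sumNorm_smul])
    have h2 : ∫ᵛ x, (c • f) x ∂<•μ = c * ∫ᵛ x, f x ∂<•μ :=
      VectorMeasure.integral_fun_smul (μ := μ) (B := (ContinuousLinearMap.lsmul ℝ ℝ).flip) c f
    rw [h2, h] at h1
    exact h1
  have hp : 0 < (1 + sumNorm f)⁻¹ := by positivity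
  have hb : (1 + sumNorm f)⁻¹ * sumNorm f ≤ 1 := by
    rw [inv_mul_le_iff₀ (by positivity)]
    linarith
  have h1 := key (1 + sumNorm f)⁻¹ (by rwa [abs_of_pos hp])
  have h2 := key (-(1 + sumNorm f)⁻¹) (by rwa [abs_neg, abs_of_pos hp])
  nlinarith

theorem eq_zero_of_integral_eq_zero {μ : SignedMeasure X}
    (h : ∀ f ∈ lip X, ∫ᵛ x, f x ∂<•μ = 0) : μ = 0 := by
  set P := μ.toJordanDecomposition.posPart with hP
  set N := μ.toJordanDecomposition.negPart with hN
  have hμ : μ = P.toSignedMeasure - N.toSignedMeasure :=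
    (SignedMeasure.toSignedMeasure_toJordanDecomposition μ).symm
  have hint : ∀ f ∈ lip X, ∫ x, f x ∂P = ∫ x, f x ∂N := by
    intro f hf
    have h1 := h f hf
    rw [hμ, VectorMeasure.integral_sub_vectorMeasure (integrable_of_mem_lip _ hf)
      (integrable_of_mem_lip _ hf), VectorMeasure.integral_toSignedMeasure,
      VectorMeasure.integral_toSignedMeasure] at h1
    exact sub_eq_zero.1 h1
  have hcl : ∀ F : Set X, IsClosed F → P F = N F := by
    intro F hF
    have hpos : ∀ n : ℕ, (0 : ℝ) < 1 / ((n : ℝ) + 1) := fun n => by positivity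
    have h1 := tendsto_lintegral_thickenedIndicator_of_isClosed P hF hpos
      tendsto_one_div_add_atTop_nhds_zero_nat
    have h2 := tendsto_lintegral_thickenedIndicator_of_isClosed N hF hpos
      tendsto_one_div_add_atTop_nhds_zero_nat
    refine tendsto_nhds_unique h1 (h2.congr fun n => ?_)
    set g := thickenedIndicator (hpos n) F with hg
    have hgl : (fun x => (g x : ℝ)) ∈ lip X :=
      ⟨_, (lipschitzWith_thickenedIndicator (hpos n) F)⟩
    have h3 := hint _ hgl
    have h4 : ∀ (m : Measure X) [IsFiniteMeasure m],
        ∫ x, (g x : ℝ) ∂m = (∫⁻ x, (g x : ENNReal) ∂m).toReal := fun m _ =>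
      (BoundedContinuousFunction.toReal_lintegral_coe_eq_integral g m).symm
    rw [h4 P, h4 N] at h3
    exact ((ENNReal.toReal_eq_toReal_iff'
      (BoundedContinuousFunction.lintegral_lt_top_of_nnreal P g).ne
      (BoundedContinuousFunction.lintegral_lt_top_of_nnreal N g).ne).1 h3).symm
  have hPN : P = N := by
    refine ext_of_generate_finite _ ?_ isPiSystem_isClosed (fun F hF => hcl F hF)
      (hcl _ isClosed_univ)
    rw [BorelSpace.measurable_eq (α := X), borel_eq_generateFrom_isClosed]
  have h5 : P.toSignedMeasure = N.toSignedMeasure := by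
    ext i hi
    rw [Measure.toSignedMeasure_apply_measurable hi, Measure.toSignedMeasure_apply_measurable hi,
      hPN]
  rw [hμ, h5, sub_self]

theorem CabvMK.core : NormedSpace.Core ℝ (CabvMK X) where
  norm_nonneg μ := mkNorm_nonneg _
  norm_smul c μ := mkNorm_smul c _
  norm_triangle μ ν := mkNorm_add_le _ _
  norm_eq_zero_iff μ := by
    constructor
    · intro h
      apply CabvMK.toSignedMeasure.injective
      rw [map_zero]
      exact eq_zero_of_integral_eq_zero fun f hf => integral_eq_zero_of_mkNorm_eq_zero h hf
    · rintro rfl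
      have h := mkNorm_smul (0 : ℝ) (0 : SignedMeasure X)
      rw [zero_smul, abs_zero, zero_mul] at h
      exact h

instance : NormedAddCommGroup (CabvMK X) := NormedAddCommGroup.ofCore CabvMK.core
instance : NormedSpace ℝ (CabvMK X) := NormedSpace.ofCore CabvMK.core

end Measures

end

end MongeKantorovich

open MongeKantorovich

/-!
The upper bound on the Monge–Kantorovich norm is elementary: for `ν` of zero charge,
`∫ f ∂μ = ∫ f ∂ν + ∫ f ∂(μ - ν) ≤ ‖f‖_L ‖ν‖_KR + ‖f‖_∞ ‖μ - ν‖_TV` (`mkNorm_le_max`).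

For the converse, the functional `f ↦ ∫ f ∂μ` has to be split into a part controlled by `‖f‖_L` and
a part controlled by `‖f‖_∞`. It is placed on the triples `(f, f, -f)` in
`Lip(X) × C(X) × C(X)`, where it is dominated by `‖μ‖_MK` times the sublinear functional
`(f, g, h) ↦ ‖f‖_L + sup (max g h 0)`, and extended by Hahn–Banach. The second and third components
of the extension are *positive* functionals on `C(X)`, because the sublinear functional vanishes on
nonpositive functions; hence the Riesz–Markov–Kakutani theorem for positive functionals applies and
gives measures `P`, `N` with `P(X) + N(X) ≤ ‖μ‖_MK`. With `σ = P - N`, the measure `ν = μ - σ`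
satisfies `∫ f ∂ν ≤ ‖μ‖_MK ‖f‖_L` for every Lipschitz `f`, so it has zero charge and
`‖ν‖_KR ≤ ‖μ‖_MK`, while `‖μ - ν‖_TV = ‖σ‖_TV ≤ ‖μ‖_MK`
(`exists_zeroCharge_krNorm_le_tvNorm_le`). The infimum is therefore attained, and the comparison
with the Hanin norm follows from `max a b ≤ a + b ≤ 2 max a b`.

Pushing `μ` forward along a simple function that moves points by at most `ε` changes it by at most
`ε ‖μ‖_TV` in the Monge–Kantorovich norm, so the span of the Dirac measures is dense
(`dense_span_diracMK`). A continuous functional `T` is thus determined by the function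
`x ↦ T δ_x`, which is Lipschitz. That integration is isometric is seen on the test measures
`±(δ_x - δ_y) / d(x, y) ± δ_z`, which have norm at most one and detect `‖f‖_L` and `‖f‖_∞`
simultaneously. Attainment of the supremum defining `‖μ‖_MK` is then the existence of norming
functionals in the dual.
-/

namespace MongeKantorovich

/-! ### Lipschitz functions and integration against signed measures -/

section Basic

variable {X : Type*}

/-- Scaling argument turning a bound on a unit ball into a bound by the seminorm; it also covers
`s = 0`, where arbitrarily large multiples are admissible. -/
theorem le_mul_of_forall_scaling {s I K : ℝ} (hs : 0 ≤ s)
    (h : ∀ c : ℝ, 0 ≤ c → c * s ≤ 1 → c * I ≤ K) : I ≤ s * K := by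
  have hK : 0 ≤ K := by simpa using h 0 le_rfl (by simp)
  rcases hs.eq_or_lt with rfl | hs
  · by_contra! hI
    rw [zero_mul] at hI
    have := h ((K + 1) / I) (by positivity) (by simp)
    rw [div_mul_cancel₀ _ hI.ne'] at this
    linarith
  · have := h s⁻¹ (by positivity) (by rw [inv_mul_cancel₀ hs.ne'])
    rwa [inv_mul_le_iff₀ hs] at this

theorem supNorm_le {f : X → ℝ} {C : ℝ} (hC : 0 ≤ C) (h : ∀ x, |f x| ≤ C) : supNorm f ≤ C :=
  Real.iSup_le h hC

section Measure

variable [MeasurableSpace X]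

theorem tvNorm_nonneg (μ : SignedMeasure X) : 0 ≤ tvNorm μ := measureReal_nonneg

theorem integral_smul_fun (μ : SignedMeasure X) (c : ℝ) (f : X → ℝ) :
    ∫ᵛ x, (c • f) x ∂<•μ = c * ∫ᵛ x, f x ∂<•μ :=
  VectorMeasure.integral_fun_smul (μ := μ) (B := (ContinuousLinearMap.lsmul ℝ ℝ).flip) c f

theorem abs_integral_le_mul_tvNorm (μ : SignedMeasure X) {f : X → ℝ} {C : ℝ} (hC : 0 ≤ C)
    (h : ∀ x, |f x| ≤ C) : |∫ᵛ x, f x ∂<•μ| ≤ C * tvNorm μ := by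
  have := isFiniteMeasure_variation μ
  have h1 := VectorMeasure.norm_integral_le_of_norm_le_const (μ := μ) (f := f)
    (B := (ContinuousLinearMap.lsmul ℝ ℝ).flip) (C := C) (Filter.Eventually.of_forall h)
  have hB : ‖(ContinuousLinearMap.lsmul ℝ ℝ : ℝ →L[ℝ] ℝ →L[ℝ] ℝ).flip‖ ≤ 1 := by
    rw [ContinuousLinearMap.opNorm_flip]
    exact ContinuousLinearMap.opNorm_lsmul_le
  calc |∫ᵛ x, f x ∂<•μ| ≤ C * ‖(ContinuousLinearMap.lsmul ℝ ℝ : ℝ →L[ℝ] ℝ →L[ℝ] ℝ).flip‖ *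
        μ.variation.real Set.univ := h1
    _ ≤ C * 1 * tvNorm μ := by
        unfold tvNorm
        gcongr
    _ = C * tvNorm μ := by rw [mul_one]

theorem integral_const_fun (μ : SignedMeasure X) (c : ℝ) :
    ∫ᵛ _, c ∂<•μ = c * μ Set.univ := by
  have := isFiniteMeasure_variation μ
  rw [VectorMeasure.integral_const]
  simp [mul_comm]

theorem integral_smul_measure (c : ℝ) (μ : SignedMeasure X) (f : X → ℝ) :
    ∫ᵛ x, f x ∂<•(c • μ) = c * ∫ᵛ x, f x ∂<•μ := by
  rw [VectorMeasure.integral_smul_vectorMeasure, smul_eq_mul]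

end Measure

variable [MetricSpace X]

theorem abs_sub_le_lipSeminorm {f : X → ℝ} (hf : f ∈ lip X) (x y : X) :
    |f x - f y| ≤ lipSeminorm f * dist x y := by
  rcases eq_or_ne x y with rfl | hxy
  · simp
  · exact (div_le_iff₀ (dist_pos.2 hxy)).1 (le_ciSup (lipSeminorm_bddAbove hf) ⟨(x, y), hxy⟩)

theorem mem_lip_of_abs_sub_le {f : X → ℝ} {C : ℝ} (h : ∀ x y, |f x - f y| ≤ C * dist x y) :
    f ∈ lip X :=
  ⟨C.toNNReal, LipschitzWith.of_dist_le' h⟩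

theorem lipSeminorm_smul (c : ℝ) (f : X → ℝ) : lipSeminorm (c • f) = |c| * lipSeminorm f := by
  unfold lipSeminorm
  rw [Real.mul_iSup_of_nonneg (abs_nonneg c)]
  refine congrArg _ (funext fun p => ?_)
  simp only [Pi.smul_apply, smul_eq_mul]
  rw [← mul_sub, abs_mul, mul_div_assoc]

theorem const_mem_lip (c : ℝ) : (fun _ : X => c) ∈ lip X :=
  ⟨0, LipschitzWith.const c⟩

theorem lipSeminorm_const (c : ℝ) : lipSeminorm (fun _ : X => c) = 0 := by
  simp [lipSeminorm]

theorem lipSeminorm_sub_const (f : X → ℝ) (c : ℝ) :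
    lipSeminorm (fun x => f x - c) = lipSeminorm f := by
  simp [lipSeminorm]

variable [MeasurableSpace X] [CompactSpace X] [BorelSpace X]

/-- Integration of Lipschitz functions against a signed measure, as a linear functional. -/
noncomputable def lipIntegral (μ : SignedMeasure X) : lip X →ₗ[ℝ] ℝ where
  toFun f := ∫ᵛ x, (f : X → ℝ) x ∂<•μ
  map_add' f g := VectorMeasure.integral_fun_add (integrable_of_mem_lip μ f.2)
    (integrable_of_mem_lip μ g.2)
  map_smul' c f := integral_smul_fun μ c f

theorem integral_add_measure (μ ν : SignedMeasure X) {f : X → ℝ} (hf : f ∈ lip X) :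
    ∫ᵛ x, f x ∂<•(μ + ν) = ∫ᵛ x, f x ∂<•μ + ∫ᵛ x, f x ∂<•ν :=
  VectorMeasure.integral_add_vectorMeasure (integrable_of_mem_lip μ hf) (integrable_of_mem_lip ν hf)

theorem integral_sub_measure (μ ν : SignedMeasure X) {f : X → ℝ} (hf : f ∈ lip X) :
    ∫ᵛ x, f x ∂<•(μ - ν) = ∫ᵛ x, f x ∂<•μ - ∫ᵛ x, f x ∂<•ν :=
  VectorMeasure.integral_sub_vectorMeasure (integrable_of_mem_lip μ hf) (integrable_of_mem_lip ν hf)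

theorem integral_dirac_mul (x : X) (c : ℝ) (f : X → ℝ) :
    ∫ᵛ y, f y ∂<•(VectorMeasure.dirac x c : SignedMeasure X) = c * f x := by
  rw [VectorMeasure.integral_dirac]
  simp

theorem abs_integral_le_sumNorm_mul_mkNorm (μ : SignedMeasure X) {f : X → ℝ} (hf : f ∈ lip X) :
    |∫ᵛ x, f x ∂<•μ| ≤ sumNorm f * mkNorm μ := by
  have key : ∀ g ∈ lip X, ∫ᵛ x, g x ∂<•μ ≤ sumNorm g * mkNorm μ := fun g hg =>
    le_mul_of_forall_scaling (sumNorm_nonneg g) fun c hc h => by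
      rw [← integral_smul_fun]
      exact integral_le_mkNorm μ (Submodule.smul_mem _ c hg)
        (by rwa [sumNorm_smul, abs_of_nonneg hc])
  refine abs_le'.2 ⟨key f hf, ?_⟩
  have h := key _ (Submodule.smul_mem _ (-1 : ℝ) hf)
  rw [sumNorm_smul, integral_smul_fun] at h
  simpa using h

end Basic

/-! ### The Kantorovich–Rubinstein norm -/

section KR

variable {X : Type*} [MetricSpace X] [MeasurableSpace X]

theorem krNorm_le (x₀ : X) {ν : SignedMeasure X} {C : ℝ}
    (h : ∀ f ∈ lip X, lipSeminorm f ≤ 1 → ∫ᵛ x, f x ∂<•ν ≤ C) : krNorm x₀ ν ≤ C := by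
  refine csSup_le
    ⟨0, 0, zero_mem _, rfl, (lipSeminorm_const (X := X) 0).trans_le zero_le_one, by simp⟩ ?_
  rintro _ ⟨f, hf, -, h1, rfl⟩
  exact h f hf h1

variable [CompactSpace X]

theorem krNorm_bddAbove (x₀ : X) (ν : SignedMeasure X) :
    BddAbove {r | ∃ f ∈ lip X, f x₀ = 0 ∧ lipSeminorm f ≤ 1 ∧ r = ∫ᵛ x, f x ∂<•ν} := by
  refine ⟨Metric.diam (Set.univ : Set X) * tvNorm ν, ?_⟩
  rintro _ ⟨f, hf, h0, h1, rfl⟩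
  refine (le_abs_self _).trans (abs_integral_le_mul_tvNorm ν Metric.diam_nonneg fun x => ?_)
  calc |f x| = |f x - f x₀| := by rw [h0, sub_zero]
    _ ≤ lipSeminorm f * dist x x₀ := abs_sub_le_lipSeminorm hf x x₀
    _ ≤ 1 * dist x x₀ := by gcongr
    _ ≤ Metric.diam (Set.univ : Set X) := by
      rw [one_mul]
      exact Metric.dist_le_diam_of_mem isCompact_univ.isBounded trivial trivial

theorem krNorm_nonneg (x₀ : X) (ν : SignedMeasure X) : 0 ≤ krNorm x₀ ν :=
  le_csSup (krNorm_bddAbove x₀ ν)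
    ⟨0, zero_mem _, rfl, (lipSeminorm_const (X := X) 0).trans_le zero_le_one, by simp⟩

variable [BorelSpace X]

/-- For a measure of zero charge the normalization `f x₀ = 0` is harmless. -/
theorem integral_le_lipSeminorm_mul_krNorm (x₀ : X) {ν : SignedMeasure X} (hν : ν ∈ zeroCharge X)
    {f : X → ℝ} (hf : f ∈ lip X) : ∫ᵛ x, f x ∂<•ν ≤ lipSeminorm f * krNorm x₀ ν := by
  have hν0 : ν Set.univ = 0 := hν
  set g : X → ℝ := fun x => f x - f x₀ with hg
  have hgl : g ∈ lip X := sub_mem hf (const_mem_lip (f x₀))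
  have hgi : ∫ᵛ x, f x ∂<•ν = ∫ᵛ x, g x ∂<•ν := by
    rw [hg, VectorMeasure.integral_fun_sub (integrable_of_mem_lip ν hf)
      (integrable_of_mem_lip ν (const_mem_lip (f x₀))), integral_const_fun, hν0, mul_zero, sub_zero]
  rw [hgi, ← lipSeminorm_sub_const f (f x₀)]
  refine le_mul_of_forall_scaling (lipSeminorm_nonneg g) fun c hc h => ?_
  rw [← integral_smul_fun]
  refine le_csSup (krNorm_bddAbove x₀ ν) ⟨c • g, Submodule.smul_mem _ c hgl, ?_, ?_, rfl⟩
  · simp [hg]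
  · rwa [lipSeminorm_smul, abs_of_nonneg hc]

theorem mkNorm_le_max (x₀ : X) (μ : SignedMeasure X) {ν : SignedMeasure X}
    (hν : ν ∈ zeroCharge X) : mkNorm μ ≤ max (krNorm x₀ ν) (tvNorm (μ - ν)) := by
  refine mkNorm_le fun f hf h => ?_
  set M := max (krNorm x₀ ν) (tvNorm (μ - ν))
  have hM : 0 ≤ M := (krNorm_nonneg x₀ ν).trans (le_max_left _ _)
  have h1 := integral_le_lipSeminorm_mul_krNorm x₀ hν hf
  have h2 := (le_abs_self _).trans
    (abs_integral_le_mul_tvNorm (μ - ν) (supNorm_nonneg f) (abs_le_supNorm hf))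
  have h3 := integral_add_measure ν (μ - ν) hf
  rw [add_sub_cancel] at h3
  calc ∫ᵛ x, f x ∂<•μ ≤ lipSeminorm f * krNorm x₀ ν + supNorm f * tvNorm (μ - ν) := by linarith
    _ ≤ lipSeminorm f * M + supNorm f * M :=
      add_le_add (mul_le_mul_of_nonneg_left (le_max_left _ _) (lipSeminorm_nonneg f))
        (mul_le_mul_of_nonneg_left (le_max_right _ _) (supNorm_nonneg f))
    _ = sumNorm f * M := by rw [sumNorm, add_mul]
    _ ≤ M := mul_le_of_le_one_left hM h

end KR

/-! ### Splitting an integral functional by Hahn–Banach and Riesz -/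

section Duality

open CompactlySupported

variable {X : Type*}

/-- Riesz–Markov–Kakutani on a compact Hausdorff space, for functionals on `C(X, ℝ)`. -/
theorem exists_measure_of_nonneg [TopologicalSpace X] [T2Space X] [CompactSpace X]
    [MeasurableSpace X] [BorelSpace X]
    (P : C(X, ℝ) →ₗ[ℝ] ℝ) (hP : ∀ g : C(X, ℝ), 0 ≤ g → 0 ≤ P g) :
    ∃ ρ : Measure X, IsFiniteMeasure ρ ∧ ∀ g : C(X, ℝ), ∫ x, g x ∂ρ = P g := by
  let Λ : C_c(X, ℝ) →ₚ[ℝ] ℝ :=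
    { toFun := fun g => P g.toContinuousMap
      map_add' := fun g g' => P.map_add g.toContinuousMap g'.toContinuousMap
      map_smul' := fun c g => P.map_smul c g.toContinuousMap
      monotone' := fun g g' h => by
        have h1 := hP (g'.toContinuousMap - g.toContinuousMap) (sub_nonneg.2 fun x => h x)
        rw [map_sub] at h1
        exact sub_nonneg.1 h1 }
  refine ⟨RealRMK.rieszMeasure Λ, inferInstance, fun g => ?_⟩
  exact RealRMK.integral_rieszMeasure Λ ⟨g, HasCompactSupport.of_compactSpace _⟩

theorem tvNorm_toSignedMeasure_sub_le [MeasurableSpace X] (P N : Measure X) [IsFiniteMeasure P]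
    [IsFiniteMeasure N] :
    tvNorm (P.toSignedMeasure - N.toSignedMeasure) ≤ P.real Set.univ + N.real Set.univ := by
  have h : (P.toSignedMeasure - N.toSignedMeasure).variation ≤ P + N := by
    refine VectorMeasure.variation_sub_le.trans ?_
    rw [Measure.variation_toSignedMeasure, Measure.variation_toSignedMeasure]
  rw [← measureReal_add_apply]
  exact ENNReal.toReal_mono (measure_ne_top _ _) (h _)

variable [MetricSpace X] [CompactSpace X]

/-- The continuous function underlying a Lipschitz function. -/
def lipToC : lip X →ₗ[ℝ] C(X, ℝ) where
  toFun f := ⟨f, by obtain ⟨K, hK⟩ := f.2; exact hK.continuous⟩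
  map_add' _ _ := rfl
  map_smul' _ _ := rfl

/-- The sublinear functional `(f, g, h) ↦ ‖f‖_L + sup (max g h 0)`. Linear functionals of
`(g, h)` dominated by the second term are pairs of positive functionals of total mass at most
one; on the triples `(f, f, -f)` it gives the sum norm of `f`. -/
noncomputable def splitGauge (u : lip X × C(X, ℝ) × C(X, ℝ)) : ℝ :=
  lipSeminorm (u.1 : X → ℝ) + ‖u.2.1 ⊔ u.2.2 ⊔ 0‖

theorem splitGauge_smul (c : ℝ) (hc : 0 < c) (u : lip X × C(X, ℝ) × C(X, ℝ)) :
    splitGauge (c • u) = c * splitGauge u := by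
  obtain ⟨f, g, h⟩ := u
  have h1 : (c • g) ⊔ (c • h) ⊔ 0 = c • (g ⊔ h ⊔ 0) := by
    ext x
    simp only [ContinuousMap.sup_apply, ContinuousMap.smul_apply, ContinuousMap.zero_apply,
      smul_eq_mul]
    rw [mul_max_of_nonneg _ _ hc.le, mul_max_of_nonneg _ _ hc.le, mul_zero]
  have h2 := lipSeminorm_smul c (f : X → ℝ)
  rw [abs_of_pos hc] at h2
  simp only [splitGauge, Prod.smul_mk, h1, norm_smul, Real.norm_eq_abs, abs_of_pos hc,
    Submodule.coe_smul, h2, mul_add]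

theorem splitGauge_add_le (u v : lip X × C(X, ℝ) × C(X, ℝ)) :
    splitGauge (u + v) ≤ splitGauge u + splitGauge v := by
  obtain ⟨f, g, h⟩ := u
  obtain ⟨f', g', h'⟩ := v
  have h1 : lipSeminorm ((f + f' : lip X) : X → ℝ) ≤ lipSeminorm (f : X → ℝ) +
    lipSeminorm (f' : X → ℝ) := lipSeminorm_add_le f.2 f'.2
  have h2 : ‖(g + g') ⊔ (h + h') ⊔ 0‖ ≤ ‖g ⊔ h ⊔ 0‖ + ‖g' ⊔ h' ⊔ 0‖ := by
    refine (ContinuousMap.norm_le _ (by positivity)).2 fun x => ?_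
    have a := (le_abs_self _).trans (ContinuousMap.norm_coe_le_norm (g ⊔ h ⊔ 0) x)
    have b := (le_abs_self _).trans (ContinuousMap.norm_coe_le_norm (g' ⊔ h' ⊔ 0) x)
    simp only [ContinuousMap.sup_apply, ContinuousMap.add_apply, ContinuousMap.zero_apply,
      max_le_iff] at a b ⊢
    rw [Real.norm_eq_abs, abs_of_nonneg (le_max_right _ _)]
    refine max_le (max_le ?_ ?_) ?_ <;> linarith
  simp only [splitGauge, Prod.mk_add_mk]
  linarith

theorem sumNorm_le_splitGauge (f : lip X) :
    sumNorm (f : X → ℝ) ≤ splitGauge (f, lipToC f, -lipToC f) := by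
  refine add_le_add le_rfl (supNorm_le (norm_nonneg _) fun x => ?_)
  have h := (le_abs_self _).trans
    (ContinuousMap.norm_coe_le_norm (lipToC f ⊔ -lipToC f ⊔ 0) x)
  exact abs_le'.2 ⟨((le_max_left _ _).trans (le_max_left _ _)).trans h,
    ((le_max_right _ _).trans (le_max_left _ _)).trans h⟩

theorem splitGauge_of_nonpos {g h : C(X, ℝ)} (hg : g ≤ 0) (hh : h ≤ 0) :
    splitGauge ((0 : lip X), g, h) = 0 := by
  have h1 : lipSeminorm ((0 : lip X) : X → ℝ) = 0 := lipSeminorm_const (X := X) 0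
  simp only [splitGauge, h1, sup_eq_right.2 (sup_le hg hh), norm_zero, add_zero]

variable [MeasurableSpace X] [BorelSpace X]

/-- The functional `f ↦ ∫ f ∂μ`, seen on the triples `(f, f, -f)`, is dominated by `mkNorm μ`
times `splitGauge`; this is its Hahn–Banach extension. -/
theorem exists_split_extension (μ : SignedMeasure X) :
    ∃ Ψ : lip X × C(X, ℝ) × C(X, ℝ) →ₗ[ℝ] ℝ,
      (∀ f : lip X, Ψ (f, lipToC f, -lipToC f) = ∫ᵛ x, (f : X → ℝ) x ∂<•μ) ∧
      ∀ u, Ψ u ≤ mkNorm μ * splitGauge u := by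
  let ι : lip X →ₗ[ℝ] lip X × C(X, ℝ) × C(X, ℝ) :=
    LinearMap.id.prod (lipToC.prod (-lipToC))
  let φ : (lip X × C(X, ℝ) × C(X, ℝ)) →ₗ.[ℝ] ℝ :=
    ⟨LinearMap.range ι, (lipIntegral μ ∘ₗ LinearMap.fst ℝ _ _) ∘ₗ (LinearMap.range ι).subtype⟩
  obtain ⟨Ψ, h1, h2⟩ := exists_extension_of_le_sublinear φ (fun u => mkNorm μ * splitGauge u)
    (fun c hc u => by rw [splitGauge_smul c hc]; ring)
    (fun u v => by
      rw [← mul_add]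
      exact mul_le_mul_of_nonneg_left (splitGauge_add_le u v) (mkNorm_nonneg μ))
    (by
      rintro ⟨_, f, rfl⟩
      refine (le_abs_self _).trans ((abs_integral_le_sumNorm_mul_mkNorm μ f.2).trans ?_)
      rw [mul_comm]
      exact mul_le_mul_of_nonneg_left (sumNorm_le_splitGauge f) (mkNorm_nonneg μ))
  exact ⟨Ψ, fun f => h1 ⟨ι f, f, rfl⟩, h2⟩

/-- The infimum representing the Monge–Kantorovich norm is attained. -/
theorem exists_zeroCharge_krNorm_le_tvNorm_le (x₀ : X) (μ : SignedMeasure X) :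
    ∃ ν ∈ zeroCharge X, krNorm x₀ ν ≤ mkNorm μ ∧ tvNorm (μ - ν) ≤ mkNorm μ := by
  have hm := mkNorm_nonneg μ
  obtain ⟨Ψ, hΨ, hle⟩ := exists_split_extension μ
  -- The gauge vanishes at `(0, -g, -h)`, which turns domination into positivity.
  have hpos : ∀ g h : C(X, ℝ), 0 ≤ g → 0 ≤ h → 0 ≤ Ψ (0, g, h) := by
    intro g h hg hh
    have h1 := hle (-(0, g, h))
    have h2 : splitGauge (-((0 : lip X), g, h)) = 0 := by
      simpa using splitGauge_of_nonpos (neg_nonpos.2 hg) (neg_nonpos.2 hh)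
    rw [h2, map_neg, mul_zero] at h1
    linarith
  obtain ⟨P, hPf, hP⟩ := exists_measure_of_nonneg
    (Ψ ∘ₗ LinearMap.inr ℝ (lip X) _ ∘ₗ LinearMap.inl ℝ C(X, ℝ) C(X, ℝ))
    fun g hg => hpos g 0 hg le_rfl
  obtain ⟨N, hNf, hN⟩ := exists_measure_of_nonneg
    (Ψ ∘ₗ LinearMap.inr ℝ (lip X) _ ∘ₗ LinearMap.inr ℝ C(X, ℝ) C(X, ℝ))
    fun g hg => hpos 0 g le_rfl hg
  simp only [LinearMap.comp_apply, LinearMap.inl_apply, LinearMap.inr_apply] at hP hN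
  set σ : SignedMeasure X := P.toSignedMeasure - N.toSignedMeasure with hσ
  have hσi : ∀ f : lip X, ∫ᵛ x, (f : X → ℝ) x ∂<•σ = Ψ (0, lipToC f, -lipToC f) := by
    intro f
    have h1 := hP (lipToC f)
    have h2 := hN (lipToC f)
    rw [hσ, integral_sub_measure _ _ f.2, VectorMeasure.integral_toSignedMeasure,
      VectorMeasure.integral_toSignedMeasure]
    calc _ = Ψ (0, lipToC f, 0) - Ψ (0, 0, lipToC f) := congrArg₂ (· - ·) h1 h2
      _ = Ψ (0, lipToC f, -lipToC f) := by
        rw [← map_sub]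
        simp
  have hνi : ∀ f : lip X,
      ∫ᵛ x, (f : X → ℝ) x ∂<•(μ - σ) ≤ mkNorm μ * lipSeminorm (f : X → ℝ) := by
    intro f
    have h1 := hle (f, 0, 0)
    have h2 : splitGauge (f, (0 : C(X, ℝ)), (0 : C(X, ℝ))) = lipSeminorm (f : X → ℝ) := by
      simp [splitGauge]
    rw [h2] at h1
    rw [integral_sub_measure _ _ f.2, hσi, ← hΨ, ← map_sub]
    simpa only [Prod.mk_sub_mk, sub_zero, sub_self, ← Prod.mk_zero_zero] using h1
  -- Constants of either sign have Lipschitz seminorm zero, which forces the charge to vanish.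
  have hν0 : (μ - σ) Set.univ = 0 := by
    have key : ∀ c : ℝ, c * (μ - σ) Set.univ ≤ 0 := by
      intro c
      have h1 := hνi ⟨_, const_mem_lip c⟩
      rwa [lipSeminorm_const, mul_zero, integral_const_fun] at h1
    have h1 := key 1
    have h2 := key (-1)
    linarith
  refine ⟨μ - σ, hν0, krNorm_le x₀ fun f hf h => ?_, ?_⟩
  · exact (hνi ⟨f, hf⟩).trans (mul_le_of_le_one_right hm h)
  · rw [sub_sub_cancel]
    have h1 : P.real Set.univ = Ψ (0, 1, 0) := by simpa using hP 1
    have h2 : N.real Set.univ = Ψ (0, 0, 1) := by simpa using hN 1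
    have h3 : splitGauge ((0 : lip X), (1 : C(X, ℝ)), (1 : C(X, ℝ))) ≤ 1 := by
      have h4 : lipSeminorm ((0 : lip X) : X → ℝ) = 0 := lipSeminorm_const (X := X) 0
      rw [splitGauge, h4, zero_add]
      refine (ContinuousMap.norm_le _ zero_le_one).2 fun x => ?_
      simp
    calc tvNorm σ ≤ P.real Set.univ + N.real Set.univ := tvNorm_toSignedMeasure_sub_le P N
      _ = Ψ (0, 1, 1) := by
        rw [h1, h2, ← map_add]
        simp
      _ ≤ mkNorm μ * 1 := (hle _).trans (mul_le_mul_of_nonneg_left h3 hm)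
      _ = mkNorm μ := mul_one _

theorem mkNorm_eq_iInf_max (x₀ : X) (μ : SignedMeasure X) :
    mkNorm μ = ⨅ ν : zeroCharge X,
      max (krNorm x₀ (ν : SignedMeasure X)) (tvNorm (μ - (ν : SignedMeasure X))) := by
  obtain ⟨ν, hν, h1, h2⟩ := exists_zeroCharge_krNorm_le_tvNorm_le x₀ μ
  refine le_antisymm (le_ciInf fun ν' => mkNorm_le_max x₀ μ ν'.2) ?_
  refine (ciInf_le ⟨0, ?_⟩ (⟨ν, hν⟩ : zeroCharge X)).trans (max_le h1 h2)
  rintro _ ⟨ν', rfl⟩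
  exact (krNorm_nonneg x₀ _).trans (le_max_left _ _)

theorem mkNorm_le_haninNorm (x₀ : X) (μ : SignedMeasure X) : mkNorm μ ≤ haninNorm x₀ μ :=
  le_ciInf fun ν => (mkNorm_le_max x₀ μ ν.2).trans
    (max_le_add_of_nonneg (krNorm_nonneg x₀ _) (tvNorm_nonneg _))

theorem haninNorm_le_two_mul_mkNorm (x₀ : X) (μ : SignedMeasure X) :
    haninNorm x₀ μ ≤ 2 * mkNorm μ := by
  obtain ⟨ν, hν, h1, h2⟩ := exists_zeroCharge_krNorm_le_tvNorm_le x₀ μ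
  refine (ciInf_le ⟨0, ?_⟩ (⟨ν, hν⟩ : zeroCharge X)).trans ?_
  · rintro _ ⟨ν', rfl⟩
    exact add_nonneg (krNorm_nonneg x₀ _) (tvNorm_nonneg _)
  · rw [two_mul]
    exact add_le_add h1 h2

end Duality

/-! ### Density of the finitely supported measures -/

section Density

variable {X : Type*} [MeasurableSpace X]

/-- The Dirac measure at `x`, as an element of `cabv(X)` with the Monge–Kantorovich norm. -/
noncomputable def diracMK (x : X) : CabvMK X :=
  CabvMK.toSignedMeasure.symm (VectorMeasure.dirac x (1 : ℝ))

theorem toSignedMeasure_diracMK (x : X) :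
    CabvMK.toSignedMeasure (diracMK x) = VectorMeasure.dirac x (1 : ℝ) := rfl

theorem smul_dirac_one (x : X) (c : ℝ) :
    c • (VectorMeasure.dirac x (1 : ℝ) : SignedMeasure X) = VectorMeasure.dirac x c := by
  ext t ht
  by_cases hx : x ∈ t <;> simp [hx, ht]

theorem map_simpleFunc_eq_sum_dirac (μ : SignedMeasure X) (s : SimpleFunc X X) :
    μ.map s = ∑ y ∈ s.range, (VectorMeasure.dirac y (μ (s ⁻¹' {y})) : SignedMeasure X) := by
  classical
  ext t ht
  -- Decompose the preimage of `t` into the finitely many fibres over points of `t`.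
  have h1 : s ⁻¹' t = ⋃ y ∈ s.range.filter (· ∈ t), s ⁻¹' {y} := by
    ext x
    simp
  rw [VectorMeasure.map_apply _ s.measurable ht, h1,
    VectorMeasure.of_biUnion_finset
      (fun a _ b _ hab => (Set.disjoint_singleton.2 hab).preimage s)
      (fun y _ => s.measurableSet_preimage _)]
  rw [Finset.sum_filter, FunLike.coe_sum, Finset.sum_apply]
  refine Finset.sum_congr rfl fun y _ => ?_
  split_ifs with hy
  · rw [VectorMeasure.dirac_apply_of_mem ht hy]
  · rw [VectorMeasure.dirac_apply_of_notMem hy]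

variable [MetricSpace X] [BorelSpace X]

theorem exists_simpleFunc_dist_le [CompactSpace X] [Nonempty X] {ε : ℝ} (hε : 0 < ε) :
    ∃ s : SimpleFunc X X, ∀ x, dist (s x) x ≤ ε := by
  -- Finitely many `ε`-balls around a dense sequence cover `X`; go to the nearest centre.
  set e := TopologicalSpace.denseSeq X
  obtain ⟨n, hn⟩ := isCompact_univ.elim_directed_cover
    (fun n : ℕ => ⋃ k ≤ n, Metric.ball (e k) ε)
    (fun n => isOpen_biUnion fun k _ => Metric.isOpen_ball)
    (fun x _ => by
      obtain ⟨k, hk⟩ := (TopologicalSpace.denseRange_denseSeq X).exists_dist_lt x hε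
      exact Set.mem_iUnion.2 ⟨k, Set.mem_biUnion (le_refl k) hk⟩)
    (directed_of_isDirected_le fun m n h =>
      Set.biUnion_subset_biUnion_left fun k hk => le_trans hk h)
  refine ⟨SimpleFunc.nearestPt e n, fun x => ?_⟩
  obtain ⟨k, hk, hx⟩ := Set.mem_iUnion₂.1 (hn (Set.mem_univ x))
  have h1 := SimpleFunc.edist_nearestPt_le e x hk
  rw [edist_dist, edist_dist, ENNReal.ofReal_le_ofReal_iff dist_nonneg, dist_comm (e k)] at h1
  exact h1.trans (Metric.mem_ball.1 hx).le

theorem mkNorm_sub_map_le [CompactSpace X] (μ : SignedMeasure X) {s : X → X} (hs : Measurable s)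
    {ε : ℝ} (hε : 0 ≤ ε) (h : ∀ x, dist (s x) x ≤ ε) :
    mkNorm (μ - μ.map s) ≤ ε * tvNorm μ := by
  have := isFiniteMeasure_variation μ
  refine mkNorm_le fun f hf h1 => ?_
  obtain ⟨K, hK⟩ := id hf
  have hi : μ.Integrable (f ∘ s) :=
    Integrable.of_bound (hK.continuous.measurable.comp hs).aestronglyMeasurable (supNorm f)
      (Filter.Eventually.of_forall fun x => abs_le_supNorm hf (s x))
  have hL : lipSeminorm f ≤ 1 := by
    have := supNorm_nonneg f
    unfold sumNorm at h1
    linarith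
  rw [integral_sub_measure _ _ hf,
    VectorMeasure.integral_map hs hK.continuous.aestronglyMeasurable hi]
  have h2 := VectorMeasure.integral_fun_sub (B := (ContinuousLinearMap.lsmul ℝ ℝ).flip)
    (integrable_of_mem_lip μ hf) hi
  refine h2.symm.trans_le ((le_abs_self _).trans (abs_integral_le_mul_tvNorm μ hε fun x => ?_))
  calc |f x - f (s x)| ≤ lipSeminorm f * dist x (s x) := abs_sub_le_lipSeminorm hf _ _
    _ ≤ 1 * dist x (s x) := by gcongr
    _ ≤ ε := by rw [one_mul, dist_comm]; exact h x

variable [CompactSpace X]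

theorem dense_span_diracMK : Dense (Submodule.span ℝ (Set.range (diracMK (X := X))) :
    Set (CabvMK X)) := by
  intro μ'
  rcases isEmpty_or_nonempty X with hX | hX
  · have : μ' = 0 := CabvMK.toSignedMeasure.injective (VectorMeasure.eq_zero_of_isEmpty _)
    rw [this]
    exact subset_closure (zero_mem _)
  refine Metric.mem_closure_iff.2 fun ε hε => ?_
  set μ : SignedMeasure X := CabvMK.toSignedMeasure μ' with hμ
  have htv : 0 < tvNorm μ + 1 := add_pos_of_nonneg_of_pos (tvNorm_nonneg μ) one_pos
  obtain ⟨s, hs⟩ := exists_simpleFunc_dist_le (X := X) (div_pos hε htv)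
  refine ⟨CabvMK.toSignedMeasure.symm (μ.map s), ?_, ?_⟩
  · rw [SetLike.mem_coe, map_simpleFunc_eq_sum_dirac, map_sum]
    refine Submodule.sum_mem _ fun y _ => ?_
    rw [← smul_dirac_one, map_smul]
    exact Submodule.smul_mem _ _ (Submodule.subset_span ⟨y, rfl⟩)
  · rw [dist_eq_norm, CabvMK.norm_def, map_sub, LinearEquiv.apply_symm_apply]
    refine (mkNorm_sub_map_le μ s.measurable (by positivity) hs).trans_lt ?_
    rw [div_mul_eq_mul_div, div_lt_iff₀ htv]
    linarith

theorem finite_support_of_mem_span_diracMK {μ : CabvMK X}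
    (h : μ ∈ Submodule.span ℝ (Set.range (diracMK (X := X)))) :
    (CabvMK.toSignedMeasure μ).variation.support.Finite := by
  induction h using Submodule.span_induction with
  | mem μ h =>
    obtain ⟨x, rfl⟩ := h
    refine (Set.finite_singleton x).subset ?_
    refine Measure.support_subset_of_isClosed isClosed_singleton ?_
    rw [toSignedMeasure_diracMK, VectorMeasure.variation_dirac, mem_ae_iff]
    simp
  | zero => simp
  | add μ ν _ _ h1 h2 =>
    refine (h1.union h2).subset ?_
    rw [map_add, ← Measure.support_add]
    exact Measure.support_mono VectorMeasure.variation_add_le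
  | smul c μ _ h =>
    refine h.subset (Measure.AbsolutelyContinuous.support_mono ?_)
    rw [map_smul, VectorMeasure.variation_smul]
    exact Measure.smul_absolutelyContinuous

end Density

/-! ### The dual space -/

section Dual

variable {X : Type*} [MetricSpace X] [MeasurableSpace X] [BorelSpace X] [CompactSpace X]

/-- Integration as a linear map from `Lip(X)` to the dual of `cabv(X)`. -/
noncomputable def integralDual : LipSum X →ₗ[ℝ] StrongDual ℝ (CabvMK X) where
  toFun f := LinearMap.mkContinuous
    { toFun := fun μ => ∫ᵛ x, (f.toLip : X → ℝ) x ∂<•μ.toSignedMeasure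
      map_add' := fun μ ν => integral_add_measure μ.toSignedMeasure ν.toSignedMeasure f.toLip.2
      map_smul' := fun c μ => integral_smul_measure c μ.toSignedMeasure _ }
    ‖f‖ fun μ => abs_integral_le_sumNorm_mul_mkNorm μ.toSignedMeasure f.toLip.2
  map_add' f g := ContinuousLinearMap.ext fun μ =>
    (lipIntegral μ.toSignedMeasure).map_add f.toLip g.toLip
  map_smul' c f := ContinuousLinearMap.ext fun μ =>
    (lipIntegral μ.toSignedMeasure).map_smul c f.toLip

theorem integralDual_apply (f : LipSum X) (μ : CabvMK X) :
    integralDual f μ = ∫ᵛ x, (f.toLip : X → ℝ) x ∂<•μ.toSignedMeasure := rfl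

theorem integralDual_diracMK (f : LipSum X) (x : X) :
    integralDual f (diracMK x) = (f.toLip : X → ℝ) x := by
  rw [integralDual_apply, toSignedMeasure_diracMK, integral_dirac_mul, one_mul]

theorem norm_diracMK_sub_le (x y : X) : ‖diracMK x - diracMK y‖ ≤ dist x y := by
  refine mkNorm_le fun f hf h => ?_
  rw [map_sub, toSignedMeasure_diracMK, toSignedMeasure_diracMK, integral_sub_measure _ _ hf,
    integral_dirac_mul, integral_dirac_mul, one_mul, one_mul]
  have h1 : lipSeminorm f ≤ 1 := (le_add_of_nonneg_right (supNorm_nonneg f)).trans h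
  calc f x - f y ≤ lipSeminorm f * dist x y :=
        (le_abs_self _).trans (abs_sub_le_lipSeminorm hf x y)
    _ ≤ dist x y := mul_le_of_le_one_left dist_nonneg h1

theorem exists_abs_le_one_mul_eq_abs (t : ℝ) : ∃ a : ℝ, |a| ≤ 1 ∧ a * t = |t| := by
  rcases le_total 0 t with h | h
  · exact ⟨1, by simp, by rw [one_mul, abs_of_nonneg h]⟩
  · exact ⟨-1, by simp, by rw [neg_one_mul, abs_of_nonpos h]⟩

/-- The test measures `±(δ_x - δ_y) / d(x, y) ± δ_z` have Monge–Kantorovich norm at most one and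
detect both terms of the sum norm at once. For `x = y` the quotient is `0`. -/
theorem div_dist_add_abs_le_norm_integralDual (f : LipSum X) (x y z : X) :
    |(f.toLip : X → ℝ) x - (f.toLip : X → ℝ) y| / dist x y + |(f.toLip : X → ℝ) z| ≤
      ‖integralDual f‖ := by
  obtain ⟨a, ha, hat⟩ := exists_abs_le_one_mul_eq_abs
    ((f.toLip : X → ℝ) x - (f.toLip : X → ℝ) y)
  obtain ⟨b, hb, hbt⟩ := exists_abs_le_one_mul_eq_abs ((f.toLip : X → ℝ) z)
  set μ : CabvMK X := (a / dist x y) • (diracMK x - diracMK y) + b • diracMK z with hμ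
  have hval : ∀ g : LipSum X, integralDual g μ =
      a / dist x y * ((g.toLip : X → ℝ) x - (g.toLip : X → ℝ) y) + b * (g.toLip : X → ℝ) z := by
    intro g
    simp only [hμ, map_add, map_smul, map_sub, integralDual_diracMK, smul_eq_mul]
  have hnorm : ‖μ‖ ≤ 1 := by
    refine mkNorm_le fun g hg h => ?_
    have h1 := hval (LipSum.toLip.symm ⟨g, hg⟩)
    rw [integralDual_apply, LinearEquiv.apply_symm_apply] at h1
    rw [h1]
    refine le_trans (add_le_add ?_ ?_) h
    · rcases eq_or_ne x y with rfl | hxy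
      · simpa using lipSeminorm_nonneg g
      · have hd := dist_pos.2 hxy
        rw [div_mul_eq_mul_div, div_le_iff₀ hd]
        refine (le_abs_self _).trans ?_
        rw [abs_mul]
        exact (mul_le_of_le_one_left (abs_nonneg _) ha).trans (abs_sub_le_lipSeminorm hg x y)
    · refine (le_abs_self _).trans ?_
      rw [abs_mul]
      exact (mul_le_of_le_one_left (abs_nonneg _) hb).trans (abs_le_supNorm hg z)
  have h2 : integralDual f μ ≤ ‖integralDual f‖ :=
    (le_abs_self _).trans ((integralDual f).unit_le_opNorm μ hnorm)
  rwa [hval, div_mul_eq_mul_div, hat, hbt] at h2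

theorem norm_integralDual [Nonempty X] (f : LipSum X) : ‖integralDual f‖ = ‖f‖ := by
  refine le_antisymm (ContinuousLinearMap.opNorm_le_bound _ (norm_nonneg f) fun μ =>
    abs_integral_le_sumNorm_mul_mkNorm μ.toSignedMeasure f.toLip.2) ?_
  have key := div_dist_add_abs_le_norm_integralDual f
  obtain ⟨x₀⟩ := ‹Nonempty X›
  rw [LipSum.norm_def, sumNorm, ← le_sub_iff_add_le]
  have hsup : ∀ x y, supNorm (f.toLip : X → ℝ) ≤ ‖integralDual f‖ -
      |(f.toLip : X → ℝ) x - (f.toLip : X → ℝ) y| / dist x y := fun x y =>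
    supNorm_le (by linarith [key x y x₀, abs_nonneg ((f.toLip : X → ℝ) x₀)])
      fun z => by linarith [key x y z]
  refine Real.iSup_le (fun p => ?_) ?_
  · linarith [hsup p.1.1 p.1.2]
  · have := hsup x₀ x₀
    rw [dist_self, div_zero] at this
    linarith

/-- A functional `T` is integration of the function `x ↦ T δ_x`. -/
theorem surjective_integralDual : Function.Surjective (integralDual (X := X)) := by
  intro T
  set f : X → ℝ := fun x => T (diracMK x) with hf
  have hfl : f ∈ lip X := mem_lip_of_abs_sub_le (C := ‖T‖) fun x y => by
    rw [hf, ← map_sub]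
    exact (T.le_opNorm _).trans
      (mul_le_mul_of_nonneg_left (norm_diracMK_sub_le x y) (norm_nonneg T))
  refine ⟨LipSum.toLip.symm ⟨f, hfl⟩, ContinuousLinearMap.ext_on dense_span_diracMK ?_⟩
  rintro _ ⟨x, rfl⟩
  rw [integralDual_diracMK, LinearEquiv.apply_symm_apply]

/-- The isometric isomorphism from `Lip(X)` onto the dual of `cabv(X)`. -/
noncomputable def integralDualEquiv [Nonempty X] : LipSum X ≃ₗᵢ[ℝ] StrongDual ℝ (CabvMK X) :=
  LinearIsometryEquiv.ofSurjective ⟨integralDual, norm_integralDual⟩ surjective_integralDual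

theorem integralDualEquiv_apply [Nonempty X] (f : LipSum X) (μ : CabvMK X) :
    integralDualEquiv f μ = ∫ᵛ x, (f.toLip : X → ℝ) x ∂<•μ.toSignedMeasure := rfl

instance [Nonempty X] : Nontrivial (CabvMK X) := by
  obtain ⟨x⟩ := ‹Nonempty X›
  refine ⟨diracMK x, 0, fun h => ?_⟩
  have h1 := congrArg (fun μ : CabvMK X => CabvMK.toSignedMeasure μ Set.univ) h
  simp [toSignedMeasure_diracMK] at h1

theorem exists_sumNorm_eq_one_mkNorm_eq_integral [Nonempty X] (μ : SignedMeasure X) :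
    ∃ f ∈ lip X, sumNorm f = 1 ∧ mkNorm μ = ∫ᵛ x, f x ∂<•μ := by
  obtain ⟨T, hT, hTμ⟩ := exists_dual_vector' ℝ (CabvMK.toSignedMeasure.symm μ)
  obtain ⟨f, rfl⟩ := (integralDualEquiv (X := X)).surjective T
  rw [LinearIsometryEquiv.norm_map] at hT
  exact ⟨f.toLip, f.toLip.2, hT, hTμ.symm⟩

end Dual

end MongeKantorovich

theorem mainTheorem1 {X : Type*} [MetricSpace X] [CompactSpace X] [MeasurableSpace X]
    [BorelSpace X] (x₀ : X) :
    (∀ μ : SignedMeasure X,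
      mkNorm μ = ⨅ ν : zeroCharge X,
        max (krNorm x₀ (ν : SignedMeasure X)) (tvNorm (μ - (ν : SignedMeasure X)))) ∧
    (∀ μ : SignedMeasure X, ∃ f ∈ lip X, sumNorm f = 1 ∧ mkNorm μ = ∫ᵛ x, f x ∂<•μ) ∧
    Dense {μ : CabvMK X | μ.toSignedMeasure.variation.support.Finite} ∧
    (∃ Φ : LipSum X ≃ₗᵢ[ℝ] StrongDual ℝ (CabvMK X), ∀ (f : LipSum X) (μ : CabvMK X),
      Φ f μ = ∫ᵛ x, (f.toLip : X → ℝ) x ∂<•μ.toSignedMeasure) ∧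
    (∀ μ : SignedMeasure X, mkNorm μ ≤ haninNorm x₀ μ ∧ haninNorm x₀ μ ≤ 2 * mkNorm μ) := by
  have : Nonempty X := ⟨x₀⟩
  exact ⟨mkNorm_eq_iInf_max x₀, exists_sumNorm_eq_one_mkNorm_eq_integral,
    dense_span_diracMK.mono fun μ hμ => finite_support_of_mem_span_diracMK hμ,
    ⟨integralDualEquiv, integralDualEquiv_apply⟩,
    fun μ => ⟨mkNorm_le_haninNorm x₀ μ, haninNorm_le_two_mul_mkNorm x₀ μ⟩⟩
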